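/- Let $A$ and $P$ be $n\times n$ positive definite matrices (real symmetric or complex Hermitian) such that $\operatorname{tr}(P^{-1/2}AP^{-1/2}) = n$, and let $0<\varepsilon\le 1$. For a right-hand side $b$ and an initial guess $x_0$, let $r_0, r_1, r_2, \ldots$ be the residuals of the preconditioned conjugate gradient method (in exact arithmetic) for $Ax=b$ with preconditioner $P$: with $H=P^{-1}$, $r_0=b-Ax_0$, $p_0=Hr_0$, and for $k=0,1,2,\ldots$ $$\alpha_k=\frac{r_k^*Hr_k}{p_k^*Ap_k},\quad x_{k+1}=x_k+\alpha_kp_k,\quad r_{k+1}=r_k-\alpha_kAp_k,\quad \beta_k=\frac{r_{k+1}^*Hr_{k+1}}{r_k^*Hr_k},\quad p_{k+1}=Hr_{k+1}+\beta_kp_k,$$ where the iterates are kept constant once $r_k=0$. Let $\|v\|_{P^{-1}}=(v^*P^{-1}v)^{1/2}$, and let $i_K(\varepsilon)$ be the number of iterations needed for an $\varepsilon$-reduction of the initial residual, that is, the least $k\ge 0$ such that $\|r_k\|_{P^{-1}}\le\varepsilon\,\|r_0\|_{P^{-1}}$. Then $i_K(\varepsilon)$ exists and $$i_K(\varepsilon)\le\left\lceil\frac{\ln(\varepsilon^{-1})+\mathcal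 D_{\mathrm{LD}}(A,P)}{\ln 2}\right\rceil,\qquad \mathcal D_{\mathrm{LD}}(A,P)=\operatorname{tr}(AP^{-1})-\ln\det(AP^{-1})-n .$$ -/

import Mathlib

open scoped ComplexOrder MatrixOrder Matrix

noncomputable section

namespace PCG

variable {𝕜 : Type*} [RCLike 𝕜] {n : ℕ}

/-- The Bregman log determinant divergence `tr (A P⁻¹) - ln det (A P⁻¹) - n`. For positive definite
`A` and `P` the trace and the determinant are real (the determinant is positive), so that taking
real parts changes nothing. -/
def divLD (A P : Matrix (Fin n) (Fin n) 𝕜) : ℝ :=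
  RCLike.re (A * P⁻¹).trace - Real.log (RCLike.re (A * P⁻¹).det) - n

/-- The symmetrically preconditioned matrix `P^{-1/2} A P^{-1/2}`, where `P^{-1/2}` is the
positive semidefinite square root of `P⁻¹`. -/
def precond (A P : Matrix (Fin n) (Fin n) 𝕜) : Matrix (Fin n) (Fin n) 𝕜 :=
  CFC.sqrt P⁻¹ * A * CFC.sqrt P⁻¹

/-- The weighted norm `‖v‖_W = (v* W v)^{1/2}`, for a positive definite matrix `W`. -/
def wnorm (W : Matrix (Fin n) (Fin n) 𝕜) (v : Fin n → 𝕜) : ℝ :=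
  √(RCLike.re (star v ⬝ᵥ W *ᵥ v))

/-- The iterate `x`, the residual `r` and the search direction `p` at one stage of PCG. -/
structure State (𝕜 : Type*) (n : ℕ) where
  x : Fin n → 𝕜
  r : Fin n → 𝕜
  p : Fin n → 𝕜

/-- The start of PCG with `H = P⁻¹`: `r₀ = b - A x₀`, `p₀ = H r₀`. -/
def init (A P : Matrix (Fin n) (Fin n) 𝕜) (b x₀ : Fin n → 𝕜) : State 𝕜 n where
  x := x₀
  r := b - A *ᵥ x₀
  p := P⁻¹ *ᵥ (b - A *ᵥ x₀)

/-- The step length `α = (r* H r) / (p* A p)`. -/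
def stepLength (A P : Matrix (Fin n) (Fin n) 𝕜) (s : State 𝕜 n) : 𝕜 :=
  (star s.r ⬝ᵥ P⁻¹ *ᵥ s.r) / (star s.p ⬝ᵥ A *ᵥ s.p)

/-- The next residual `r - α A p`. -/
def nextResidual (A P : Matrix (Fin n) (Fin n) 𝕜) (s : State 𝕜 n) : Fin n → 𝕜 :=
  s.r - stepLength A P s • A *ᵥ s.p

/-- The coefficient `β = (r'* H r') / (r* H r)`, where `r'` is the next residual. -/
def beta (A P : Matrix (Fin n) (Fin n) 𝕜) (s : State 𝕜 n) : 𝕜 :=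
  (star (nextResidual A P s) ⬝ᵥ P⁻¹ *ᵥ nextResidual A P s) / (star s.r ⬝ᵥ P⁻¹ *ᵥ s.r)

/-- One PCG iteration. -/
def step (A P : Matrix (Fin n) (Fin n) 𝕜) (s : State 𝕜 n) : State 𝕜 n where
  x := s.x + stepLength A P s • s.p
  r := nextResidual A P s
  p := P⁻¹ *ᵥ nextResidual A P s + beta A P s • s.p

/-- The state of PCG after `k` iterations for `A x = b` with preconditioner `P` and initial guess
`x₀`. If some residual vanishes, then so does the search direction, and the convention `0 / 0 = 0`
keeps the state constant from there on (the algorithm has stopped at the exact solution). -/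
def iter (A P : Matrix (Fin n) (Fin n) 𝕜) (b x₀ : Fin n → 𝕜) : ℕ → State 𝕜 n
  | 0 => init A P b x₀
  | k + 1 => step A P (iter A P b x₀ k)

/-- The residual `r_k` of PCG. -/
def residual (A P : Matrix (Fin n) (Fin n) 𝕜) (b x₀ : Fin n → 𝕜) (k : ℕ) : Fin n → 𝕜 :=
  (iter A P b x₀ k).r

/-- `i` is the number of PCG iterations needed for an `ε`-reduction of the initial residual in the
norm `‖·‖_{P⁻¹}`: the first index `k` with `‖r_k‖_{P⁻¹} ≤ ε ‖r₀‖_{P⁻¹}`. -/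
def IsIterationCount (A P : Matrix (Fin n) (Fin n) 𝕜) (b x₀ : Fin n → 𝕜) (ε : ℝ) (i : ℕ) : Prop :=
  IsLeast {k : ℕ | wnorm P⁻¹ (residual A P b x₀ k) ≤ ε * wnorm P⁻¹ (residual A P b x₀ 0)} i

end PCG

end

/-! The potential `psi A X` = tr(AX) - ln det(AX) is at least n for every positive definite X, and
it equals n + D at X = H = P⁻¹. Step k of CG replaces the rank one part of X seen by r_k, namely
uu*/ρ with u = H r_k, by pp*/δ with p = p_k. X stays positive definite (`update_posDef_and_det`) and
the drop of `psi` is explicit (`psi_update`). With a = ρ_k/δ_k and b = ρ_{k+1}/ρ_k, conjugacy lets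
the drops be regrouped into terms (1+b)/a - 1 + ln a ≥ ln(1+b) ≥ ln(2√b). These telescope to k ln 2
+ ln(‖r_k‖/‖r_0‖), which therefore cannot exceed D (`log_bound`). -/

open scoped ComplexOrder MatrixOrder Matrix

namespace PCG

/-! ### The log determinant potential and its rank one updates -/

section RankOne

variable {𝕜 : Type*} [RCLike 𝕜] {n : ℕ}

/-- The potential `tr (A X) - ln det (A X)`. -/
noncomputable def psi (A X : Matrix (Fin n) (Fin n) 𝕜) : ℝ :=
  RCLike.re (A * X).trace - Real.log (RCLike.re (A * X).det)

lemma star_dotProduct_mulVec_comm {M : Matrix (Fin n) (Fin n) 𝕜} (hM : M.IsHermitian)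
    (x y : Fin n → 𝕜) : star (star x ⬝ᵥ M *ᵥ y) = star y ⬝ᵥ M *ᵥ x := by
  rw [← Matrix.star_dotProduct_star, star_star, Matrix.star_mulVec, hM.eq,
    Matrix.dotProduct_mulVec, dotProduct_comm, dotProduct_comm]

lemma star_dotProduct_mulVec_self {M : Matrix (Fin n) (Fin n) 𝕜} (hM : M.IsHermitian)
    (x : Fin n → 𝕜) :
    star x ⬝ᵥ M *ᵥ x = ((RCLike.re (star x ⬝ᵥ M *ᵥ x) : ℝ) : 𝕜) :=
  (RCLike.conj_eq_iff_re.1 (star_dotProduct_mulVec_comm hM x x)).symm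

lemma log_re_det_le_re_trace_sub {M : Matrix (Fin n) (Fin n) 𝕜} (hM : M.PosDef) :
    Real.log (RCLike.re M.det) ≤ RCLike.re M.trace - n := by
  have hpos := hM.eigenvalues_pos
  rw [hM.isHermitian.det_eq_prod_eigenvalues, hM.isHermitian.trace_eq_sum_eigenvalues,
    ← RCLike.ofReal_prod, ← RCLike.ofReal_sum, RCLike.ofReal_re, RCLike.ofReal_re,
    Real.log_prod fun i _ => (hpos i).ne']
  calc _ ≤ ∑ i, (hM.isHermitian.eigenvalues i - 1) :=
        Finset.sum_le_sum fun i _ => Real.log_le_sub_one_of_pos (hpos i)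
    _ = _ := by simp

/-- With S the square root of X, SAS is positive definite and has the trace and determinant of AX;
each eigenvalue satisfies λ - ln λ ≥ 1. -/
lemma natCast_le_psi {A X : Matrix (Fin n) (Fin n) 𝕜} (hA : A.PosDef) (hX : X.PosDef) :
    (n : ℝ) ≤ psi A X := by
  set S := CFC.sqrt X with hS
  have hSS : S * S = X := CFC.sqrt_mul_sqrt_self X hX.posSemidef.nonneg
  have hSH : Sᴴ = S := (Matrix.nonneg_iff_posSemidef.1 (CFC.sqrt_nonneg X)).isHermitian
  have hSu : IsUnit S := by
    have := hX.isUnit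
    rw [← hSS] at this
    exact isUnit_of_mul_isUnit_left this
  have hM : (S * A * S).PosDef := by
    have := hA.mul_mul_conjTranspose_same (B := S) (Matrix.vecMul_injective_of_isUnit hSu)
    rwa [hSH] at this
  have h := log_re_det_le_re_trace_sub hM
  have hdet : (S * A * S).det = (A * X).det := by
    rw [← hSS]; simp only [Matrix.det_mul]; ring
  have htr : (S * A * S).trace = (A * X).trace := by
    rw [← hSS, Matrix.mul_assoc, Matrix.trace_mul_comm, Matrix.mul_assoc]
  rw [hdet, htr] at h
  unfold psi
  linarith

/-- Replacing the action of `X` on `r` by the rank one term of `p`: the update stays positive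
definite and the determinant is multiplied by `ρ / δ`. -/
lemma update_posDef_and_det {X : Matrix (Fin n) (Fin n) 𝕜} (hX : X.PosDef) {r p u : Fin n → 𝕜}
    {ρ δ : ℝ} (hρ : 0 < ρ) (hδ : 0 < δ) (hu : X *ᵥ r = u) (hru : star r ⬝ᵥ u = (ρ : 𝕜))
    (hrp : star r ⬝ᵥ p = (ρ : 𝕜)) :
    (X - ((ρ⁻¹ : ℝ) : 𝕜) • Matrix.vecMulVec u (star u)
      + ((δ⁻¹ : ℝ) : 𝕜) • Matrix.vecMulVec p (star p)).PosDef ∧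
    (X - ((ρ⁻¹ : ℝ) : 𝕜) • Matrix.vecMulVec u (star u)
      + ((δ⁻¹ : ℝ) : 𝕜) • Matrix.vecMulVec p (star p)).det = X.det * ((ρ / δ : ℝ) : 𝕜) := by
  set c : ℝ := (√(ρ * δ))⁻¹ with hc
  have hc2 : ρ * c ^ 2 = δ⁻¹ := by
    rw [hc, inv_pow, Real.sq_sqrt (by positivity)]; field_simp
  -- G = 1 + w r* fixes X - uu*/ρ under congruence, as r* annihilates it, and sends u to cρ p. This
  -- c makes (cρ)²/ρ = 1/δ.
  set w : Fin n → 𝕜 := (c : 𝕜) • p - ((ρ⁻¹ : ℝ) : 𝕜) • u with hw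
  set G : Matrix (Fin n) (Fin n) 𝕜 := 1 + Matrix.vecMulVec w (star r) with hG
  have hρ' : (ρ : 𝕜) ≠ 0 := by exact_mod_cast hρ.ne'
  have hdetG : G.det = ((c * ρ : ℝ) : 𝕜) := by
    rw [hG, Matrix.vecMulVec_eq Unit, Matrix.det_one_add_replicateCol_mul_replicateRow, hw,
      dotProduct_sub, dotProduct_smul, dotProduct_smul, hrp, hru]
    simp [hρ']
  have hur : star u ⬝ᵥ r = (ρ : 𝕜) := by
    have := congrArg star hru
    rw [← Matrix.star_dotProduct_star, star_star] at this
    simpa using this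
  have hrX : star r ᵥ* X = star u := by
    rw [← hu, Matrix.star_mulVec, hX.isHermitian.eq]
  have hGH : Gᴴ = 1 + Matrix.vecMulVec r (star w) := by
    rw [hG, Matrix.conjTranspose_add, Matrix.conjTranspose_vecMulVec]; simp
  have key : G * X * Gᴴ = X - ((ρ⁻¹ : ℝ) : 𝕜) • Matrix.vecMulVec u (star u)
      + ((δ⁻¹ : ℝ) : 𝕜) • Matrix.vecMulVec p (star p) := by
    rw [hGH, hG, Matrix.add_mul, Matrix.one_mul, Matrix.vecMulVec_mul, hrX, Matrix.mul_add,
      Matrix.mul_one, Matrix.add_mul, Matrix.mul_vecMulVec, hu, Matrix.vecMulVec_mul_vecMulVec,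
      hur, hw, ← hc2]
    ext i j
    simp only [Matrix.add_apply, Matrix.sub_apply, Matrix.smul_apply, Matrix.vecMulVec_apply,
      Pi.sub_apply, Pi.smul_apply, Pi.star_apply, smul_eq_mul, star_sub, star_mul',
      RCLike.star_def, RCLike.conj_ofReal, RCLike.ofReal_mul, RCLike.ofReal_pow]
    rw [RCLike.ofReal_inv ρ]
    field_simp
    ring
  have hGu : IsUnit G := by
    rw [Matrix.isUnit_iff_isUnit_det, hdetG, isUnit_iff_ne_zero]
    have : c * ρ ≠ 0 := by positivity
    exact_mod_cast this
  rw [← key]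
  refine ⟨hX.mul_mul_conjTranspose_same (Matrix.vecMul_injective_of_isUnit hGu), ?_⟩
  rw [Matrix.det_mul, Matrix.det_mul, Matrix.det_conjTranspose, hdetG, RCLike.star_def,
    RCLike.conj_ofReal]
  have : ρ / δ = (c * ρ) * (c * ρ) := by rw [div_eq_mul_inv, ← hc2]; ring
  rw [this, RCLike.ofReal_mul (c * ρ)]
  ring

lemma psi_update {A X : Matrix (Fin n) (Fin n) 𝕜} (hA : A.PosDef) (hX : X.PosDef)
    {r p u : Fin n → 𝕜} {ρ δ σ : ℝ} (hρ : 0 < ρ) (hδ : 0 < δ) (hu : X *ᵥ r = u)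
    (hru : star r ⬝ᵥ u = (ρ : 𝕜)) (hrp : star r ⬝ᵥ p = (ρ : 𝕜))
    (hpA : star p ⬝ᵥ A *ᵥ p = (δ : 𝕜)) (huA : star u ⬝ᵥ A *ᵥ u = (σ : 𝕜)) :
    psi A (X - ((ρ⁻¹ : ℝ) : 𝕜) • Matrix.vecMulVec u (star u)
      + ((δ⁻¹ : ℝ) : 𝕜) • Matrix.vecMulVec p (star p)) =
      psi A X - (σ / ρ - 1 + Real.log (ρ / δ)) := by
  have hAX : 0 < RCLike.re (A * X).det := by
    have := mul_pos hA.det_pos hX.det_pos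
    rw [← Matrix.det_mul] at this
    exact (RCLike.pos_iff.1 this).1
  have hdet := (update_posDef_and_det hX hρ hδ hu hru hrp).2
  unfold psi
  rw [Matrix.det_mul, hdet, ← mul_assoc, ← Matrix.det_mul, RCLike.re_mul_ofReal,
    Real.log_mul hAX.ne' (by positivity), Matrix.mul_add, Matrix.mul_sub, Matrix.trace_add,
    Matrix.trace_sub, Matrix.mul_smul, Matrix.mul_smul, Matrix.trace_smul, Matrix.trace_smul,
    Matrix.mul_vecMulVec, Matrix.mul_vecMulVec, Matrix.trace_vecMulVec, Matrix.trace_vecMulVec,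
    dotProduct_comm, huA, dotProduct_comm, hpA]
  simp only [smul_eq_mul, ← RCLike.ofReal_mul, map_add, map_sub, RCLike.ofReal_re]
  field_simp
  ring

end RankOne

end PCG

namespace PCG

/-! ### Conjugate gradient recurrences and the decrease of the potential -/

section Recurrence

variable {𝕜 : Type*} [RCLike 𝕜] {n : ℕ}

/-- Residuals `r` and directions `p` obeying the conjugate gradient recurrences for the matrix `A`
and the inverse preconditioner `H`, with `ρ k = (r k)* H (r k)` and `δ k = (p k)* A (p k)`. -/
structure IsCG (A H : Matrix (Fin n) (Fin n) 𝕜) (r p : ℕ → Fin n → 𝕜) (ρ δ : ℕ → ℝ) : Prop where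
  rho_eq : ∀ k, star (r k) ⬝ᵥ H *ᵥ r k = (ρ k : 𝕜)
  delta_eq : ∀ k, star (p k) ⬝ᵥ A *ᵥ p k = (δ k : 𝕜)
  p_zero : p 0 = H *ᵥ r 0
  r_succ : ∀ k, r (k + 1) = r k - ((ρ k / δ k : ℝ) : 𝕜) • A *ᵥ p k
  p_succ : ∀ k, p (k + 1) = H *ᵥ r (k + 1) + ((ρ (k + 1) / ρ k : ℝ) : 𝕜) • p k

namespace IsCG

variable {A H : Matrix (Fin n) (Fin n) 𝕜} {r p : ℕ → Fin n → 𝕜} {ρ δ : ℕ → ℝ}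

lemma rho_nonneg (h : IsCG A H r p ρ δ) (hH : H.PosDef) (k : ℕ) : 0 ≤ ρ k := by
  have := hH.posSemidef.re_dotProduct_nonneg (r k)
  rwa [h.rho_eq, RCLike.ofReal_re] at this

lemma rho_pos (h : IsCG A H r p ρ δ) (hH : H.PosDef) {k : ℕ} (hk : r k ≠ 0) : 0 < ρ k := by
  have := hH.re_dotProduct_pos hk
  rwa [h.rho_eq, RCLike.ofReal_re] at this

lemma r_eq_zero_of_le (h : IsCG A H r p ρ δ) {j k : ℕ} (hj : r j = 0) (hjk : j ≤ k) :
    r k = 0 := by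
  induction k, hjk using Nat.le_induction with
  | base => exact hj
  | succ k _ ih =>
    have hρ : ρ k = 0 := by
      have := h.rho_eq k
      rw [ih] at this
      simpa using this.symm
    rw [h.r_succ, ih, hρ]
    simp

lemma r_dot_p (h : IsCG A H r p ρ δ) (hA : A.PosDef) (hH : H.PosDef) {k : ℕ} (hk : r k ≠ 0) :
    star (r k) ⬝ᵥ p k = (ρ k : 𝕜) ∧ 0 < δ k ∧ star (p k) ⬝ᵥ r (k + 1) = 0 := by
  have aux : ∀ k, r k ≠ 0 → star (r k) ⬝ᵥ p k = (ρ k : 𝕜) →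
      0 < δ k ∧ star (p k) ⬝ᵥ r (k + 1) = 0 := by
    intro k hk hrp
    have hρ := h.rho_pos hH hk
    have hp : p k ≠ 0 := by
      intro h0
      rw [h0, dotProduct_zero] at hrp
      exact hρ.ne (by exact_mod_cast hrp)
    have hδ : 0 < δ k := by
      have := hA.re_dotProduct_pos hp
      rwa [h.delta_eq, RCLike.ofReal_re] at this
    refine ⟨hδ, ?_⟩
    have hpr : star (p k) ⬝ᵥ r k = (ρ k : 𝕜) := by
      have := congrArg star hrp
      rw [← Matrix.star_dotProduct_star, star_star] at this
      simpa using this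
    rw [h.r_succ, dotProduct_sub, dotProduct_smul, h.delta_eq, hpr, smul_eq_mul,
      ← RCLike.ofReal_mul, div_mul_cancel₀ _ hδ.ne', sub_self]
  refine (fun h1 => ⟨h1, aux k hk h1⟩) ?_
  induction k with
  | zero => rw [h.p_zero, h.rho_eq]
  | succ k ih =>
    have hk' : r k ≠ 0 := fun h0 => hk (h.r_eq_zero_of_le h0 k.le_succ)
    have h0 := congrArg star (aux k hk' (ih hk')).2
    rw [← Matrix.star_dotProduct_star, star_star, star_zero] at h0
    rw [h.p_succ, dotProduct_add, h.rho_eq, dotProduct_smul, h0, smul_zero, add_zero]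

lemma A_mulVec_p (h : IsCG A H r p ρ δ) (hA : A.PosDef) (hH : H.PosDef) {k : ℕ} (hk : r k ≠ 0) :
    A *ᵥ p k = ((δ k / ρ k : ℝ) : 𝕜) • (r k - r (k + 1)) := by
  have hρ := (h.rho_pos hH hk).ne'
  have hδ := (h.r_dot_p hA hH hk).2.1.ne'
  rw [h.r_succ, sub_sub_cancel, smul_smul, ← RCLike.ofReal_mul]
  have : δ k / ρ k * (ρ k / δ k) = 1 := by field_simp
  rw [this, RCLike.ofReal_one, one_smul]

/-- H r_k lies in the span of p_k and p_{k-1}. -/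
lemma r_dot_H_of_p_dot (h : IsCG A H r p ρ δ) (hH : H.PosDef) {w : Fin n → 𝕜} {k : ℕ}
    (hw : ∀ j ≤ k, star (p j) ⬝ᵥ w = 0) : star (r k) ⬝ᵥ H *ᵥ w = 0 := by
  have e : star (r k) ⬝ᵥ H *ᵥ w = star (H *ᵥ r k) ⬝ᵥ w := by
    rw [Matrix.star_mulVec, hH.isHermitian.eq, Matrix.dotProduct_mulVec]
  rw [e]
  cases k with
  | zero => rw [← h.p_zero]; exact hw 0 le_rfl
  | succ k =>
    have : H *ᵥ r (k + 1) = p (k + 1) - ((ρ (k + 1) / ρ k : ℝ) : 𝕜) • p k := by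
      rw [h.p_succ, add_sub_cancel_right]
    rw [this, star_sub, star_smul, sub_dotProduct, smul_dotProduct, hw _ le_rfl,
      hw _ k.le_succ, smul_zero, sub_zero]

/-- The residuals are orthogonal to the previous directions, and the directions are conjugate. -/
lemma orthogonal (h : IsCG A H r p ρ δ) (hA : A.PosDef) (hH : H.PosDef) {k : ℕ} (hk : r k ≠ 0) :
    ∀ j < k, star (p j) ⬝ᵥ r k = 0 ∧ star (p j) ⬝ᵥ A *ᵥ p k = 0 := by
  induction k with
  | zero => intro j hj; omega
  | succ k ih =>
    have hne : ∀ j ≤ k, r j ≠ 0 := fun j hj h0 => hk (h.r_eq_zero_of_le h0 (by omega))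
    have ih := ih (hne k le_rfl)
    have h1 : ∀ j ≤ k, star (p j) ⬝ᵥ r (k + 1) = 0 := by
      intro j hj
      rcases hj.lt_or_eq with hj | rfl
      · rw [h.r_succ, dotProduct_sub, dotProduct_smul, (ih j hj).1, (ih j hj).2, smul_zero,
          sub_zero]
      · exact (h.r_dot_p hA hH (hne j le_rfl)).2.2
    intro j hj
    have hj : j ≤ k := by omega
    refine ⟨h1 j hj, ?_⟩
    have hrH : ∀ i ≤ k, star (r i) ⬝ᵥ H *ᵥ r (k + 1) = 0 := fun i hi =>
      h.r_dot_H_of_p_dot hH fun l hl => h1 l (hl.trans hi)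
    -- A p_j is a multiple of r_j - r_{j+1}, so conjugacy reduces to H-orthogonality of residuals;
    -- only j = k leaves a term, which the choice of β cancels.
    have e : star (p j) ⬝ᵥ A *ᵥ (H *ᵥ r (k + 1)) =
        ((δ j / ρ j : ℝ) : 𝕜) * (star (r j) ⬝ᵥ H *ᵥ r (k + 1) -
          star (r (j + 1)) ⬝ᵥ H *ᵥ r (k + 1)) := by
      have : star (p j) ⬝ᵥ A *ᵥ (H *ᵥ r (k + 1)) = star (A *ᵥ p j) ⬝ᵥ (H *ᵥ r (k + 1)) := by
        rw [Matrix.star_mulVec, hA.isHermitian.eq, Matrix.dotProduct_mulVec]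
      rw [this, h.A_mulVec_p hA hH (hne j hj), star_smul, star_sub, smul_dotProduct,
        sub_dotProduct, RCLike.star_def, RCLike.conj_ofReal, smul_eq_mul]
    rw [h.p_succ, Matrix.mulVec_add, dotProduct_add, Matrix.mulVec_smul, dotProduct_smul, e,
      hrH j hj]
    rcases hj.lt_or_eq with hj | rfl
    · rw [(ih j hj).2, hrH (j + 1) hj]; simp
    · have hρ : (ρ j : 𝕜) ≠ 0 := by exact_mod_cast (h.rho_pos hH (hne j le_rfl)).ne'
      rw [h.delta_eq, h.rho_eq, smul_eq_mul, RCLike.ofReal_div, RCLike.ofReal_div]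
      field_simp
      ring

lemma H_mulVec_r_dot_A (h : IsCG A H r p ρ δ) (hA : A.PosDef) (hH : H.PosDef) {k : ℕ}
    (hk : r (k + 1) ≠ 0) :
    star (H *ᵥ r (k + 1)) ⬝ᵥ A *ᵥ (H *ᵥ r (k + 1)) =
      ((δ (k + 1) + (ρ (k + 1) / ρ k) ^ 2 * δ k : ℝ) : 𝕜) := by
  have e : H *ᵥ r (k + 1) = p (k + 1) - ((ρ (k + 1) / ρ k : ℝ) : 𝕜) • p k := by
    rw [h.p_succ, add_sub_cancel_right]
  have h1 := (h.orthogonal hA hH hk k k.lt_succ_self).2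
  have h2 := congrArg star h1
  rw [star_dotProduct_mulVec_comm hA.isHermitian, star_zero] at h2
  rw [e, Matrix.mulVec_sub, Matrix.mulVec_smul, star_sub, star_smul, sub_dotProduct,
    dotProduct_sub, dotProduct_sub, smul_dotProduct, smul_dotProduct, dotProduct_smul,
    dotProduct_smul, h.delta_eq, h.delta_eq, h1, h2, RCLike.star_def, RCLike.conj_ofReal]
  simp only [smul_eq_mul, RCLike.ofReal_add, RCLike.ofReal_mul, RCLike.ofReal_pow]
  ring

/-- The potential of the `k`-th update decreases by the amount that the residual norms dictate. -/
lemma exists_update (h : IsCG A H r p ρ δ) (hA : A.PosDef) (hH : H.PosDef) (k : ℕ)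
    (hk : r k ≠ 0) :
    ∃ X : Matrix (Fin n) (Fin n) 𝕜, X.PosDef ∧
      (∀ w, (∀ j ≤ k, star (p j) ⬝ᵥ w = 0) → X *ᵥ w = H *ᵥ w) ∧
      psi A X ≤ psi A H - (k * Real.log 2 + (Real.log (ρ k) - Real.log (ρ 0)) / 2
        + (δ k / ρ k - 1 + Real.log (ρ k / δ k))) := by
  -- The update changes X only along vectors orthogonal to w, so X and H still agree on all later
  -- residuals.
  have keep : ∀ (k : ℕ) (X : Matrix (Fin n) (Fin n) 𝕜) (w : Fin n → 𝕜),
      (∀ j ≤ k, star (p j) ⬝ᵥ w = 0) → X *ᵥ w = H *ᵥ w →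
      (X - (((ρ k)⁻¹ : ℝ) : 𝕜) • Matrix.vecMulVec (H *ᵥ r k) (star (H *ᵥ r k))
        + (((δ k)⁻¹ : ℝ) : 𝕜) • Matrix.vecMulVec (p k) (star (p k))) *ᵥ w = H *ᵥ w := by
    intro k X w hw hXw
    have hu : star (H *ᵥ r k) ⬝ᵥ w = 0 := by
      rw [Matrix.star_mulVec, hH.isHermitian.eq, ← Matrix.dotProduct_mulVec]
      exact h.r_dot_H_of_p_dot hH hw
    rw [Matrix.add_mulVec, Matrix.sub_mulVec, Matrix.smul_mulVec, Matrix.smul_mulVec,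
      Matrix.vecMulVec_mulVec, Matrix.vecMulVec_mulVec, hu, hw k le_rfl, hXw]
    simp
  induction k with
  | zero =>
    have hρ := h.rho_pos hH hk
    obtain ⟨hrp, hδ, -⟩ := h.r_dot_p hA hH hk
    refine ⟨_, (update_posDef_and_det hH hρ hδ rfl (h.rho_eq 0) hrp).1,
      fun w hw => keep 0 H w hw rfl, ?_⟩
    rw [psi_update hA hH hρ hδ rfl (h.rho_eq 0) hrp (h.delta_eq 0)
      (by rw [← h.p_zero, h.delta_eq])]
    simp
  | succ k ih =>
    have hk' : r k ≠ 0 := fun h0 => hk (h.r_eq_zero_of_le h0 k.le_succ)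
    obtain ⟨X, hX, hXw, hψ⟩ := ih hk'
    have hρ := h.rho_pos hH hk
    obtain ⟨hrp, hδ, -⟩ := h.r_dot_p hA hH hk
    have hρ' := h.rho_pos hH hk'
    have hδ' := (h.r_dot_p hA hH hk').2.1
    have hu : X *ᵥ r (k + 1) = H *ᵥ r (k + 1) :=
      hXw _ fun j hj => (h.orthogonal hA hH hk j (by omega)).1
    refine ⟨_, (update_posDef_and_det hX hρ hδ hu (h.rho_eq _) hrp).1,
      fun w hw => keep (k + 1) X w hw (hXw w fun j hj => hw j (by omega)), ?_⟩
    rw [psi_update hA hX hρ hδ hu (h.rho_eq _) hrp (h.delta_eq _) (h.H_mulVec_r_dot_A hA hH hk)]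
    set a := ρ k / δ k with ha
    set b := ρ (k + 1) / ρ k with hb
    have ha0 : 0 < a := by positivity
    have hb0 : 0 < b := by positivity
    have e1 : (δ (k + 1) + b ^ 2 * δ k) / ρ (k + 1) = δ (k + 1) / ρ (k + 1) + b / a := by
      rw [hb, ha]; field_simp
    have e2 : δ k / ρ k = 1 / a := by rw [ha, one_div_div]
    -- The summand b/a of this drop joins the 1/a - 1 + ln a left open by the previous step.
    have hlog : Real.log (1 + b) ≤ (1 + b) / a - 1 + Real.log a := by
      have := Real.log_le_sub_one_of_pos (x := (1 + b) / a) (by positivity)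
      rw [Real.log_div (by positivity) ha0.ne'] at this
      linarith
    -- The ln 2 comes from 1 + b ≥ 2√b.
    have hamgm : Real.log 2 + (Real.log (ρ (k + 1)) - Real.log (ρ k)) / 2 ≤ Real.log (1 + b) := by
      rw [← Real.log_div hρ.ne' hρ'.ne', ← Real.log_sqrt hb0.le,
        ← Real.log_mul two_ne_zero (by positivity)]
      refine Real.log_le_log (by positivity) ?_
      nlinarith [Real.sq_sqrt hb0.le, sq_nonneg (√b - 1)]
    rw [e2] at hψ
    rw [e1]
    have e3 : (1 + b) / a = 1 / a + b / a := add_div _ _ _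
    push_cast
    linarith

/-- The residual norm bound `2 ^ k * ‖r k‖ ≤ exp D * ‖r 0‖` in logarithmic form. -/
lemma log_bound (h : IsCG A H r p ρ δ) (hA : A.PosDef) (hH : H.PosDef) {k : ℕ} (hk : r k ≠ 0) :
    k * Real.log 2 + (Real.log (ρ k) - Real.log (ρ 0)) / 2 ≤ psi A H - n := by
  obtain ⟨X, hX, -, hψ⟩ := h.exists_update hA hH k hk
  have h1 := natCast_le_psi hA hX
  have hρ := h.rho_pos hH hk
  have hδ := (h.r_dot_p hA hH hk).2.1
  -- The unpaired last term 1/a - 1 + ln a is nonnegative and can be dropped.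
  have h2 := Real.log_le_sub_one_of_pos (x := δ k / ρ k) (by positivity)
  rw [Real.log_div hδ.ne' hρ.ne'] at h2
  rw [Real.log_div hρ.ne' hδ.ne'] at hψ
  linarith

end IsCG

end Recurrence

/-! ### From the logarithmic bound to the iteration count -/

section IterationCount

variable {𝕜 : Type*} [RCLike 𝕜] {n : ℕ}

lemma isCG_iter {A P : Matrix (Fin n) (Fin n) 𝕜} (hA : A.PosDef) (hP : P.PosDef)
    (b x₀ : Fin n → 𝕜) :
    IsCG A P⁻¹ (residual A P b x₀) (fun k => (iter A P b x₀ k).p)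
      (fun k => RCLike.re (star (residual A P b x₀ k) ⬝ᵥ P⁻¹ *ᵥ residual A P b x₀ k))
      (fun k => RCLike.re (star (iter A P b x₀ k).p ⬝ᵥ A *ᵥ (iter A P b x₀ k).p)) where
  rho_eq k := star_dotProduct_mulVec_self hP.inv.isHermitian _
  delta_eq k := star_dotProduct_mulVec_self hA.isHermitian _
  p_zero := rfl
  r_succ k := by
    rw [RCLike.ofReal_div, ← star_dotProduct_mulVec_self hP.inv.isHermitian,
      ← star_dotProduct_mulVec_self hA.isHermitian]
    rfl
  p_succ k := by
    rw [RCLike.ofReal_div, ← star_dotProduct_mulVec_self hP.inv.isHermitian,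
      ← star_dotProduct_mulVec_self hP.inv.isHermitian]
    rfl

lemma divLD_eq_psi_sub (A P : Matrix (Fin n) (Fin n) 𝕜) : divLD A P = psi A P⁻¹ - n := rfl

lemma divLD_nonneg {A P : Matrix (Fin n) (Fin n) 𝕜} (hA : A.PosDef) (hP : P.PosDef) :
    0 ≤ divLD A P := by
  rw [divLD_eq_psi_sub]
  linarith [natCast_le_psi hA hP.inv]

/-- Once `k ln 2 ≥ ln ε⁻¹ + D`, the residual has been reduced by the factor `ε`. -/
lemma wnorm_residual_le {A P : Matrix (Fin n) (Fin n) 𝕜} (hA : A.PosDef) (hP : P.PosDef)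
    (b x₀ : Fin n → 𝕜) {ε : ℝ} (hε : 0 < ε) {k : ℕ}
    (hk : Real.log ε⁻¹ + divLD A P ≤ k * Real.log 2) :
    wnorm P⁻¹ (residual A P b x₀ k) ≤ ε * wnorm P⁻¹ (residual A P b x₀ 0) := by
  have h := isCG_iter hA hP b x₀
  by_cases h0 : residual A P b x₀ k = 0
  · rw [h0]
    have : wnorm P⁻¹ (0 : Fin n → 𝕜) = 0 := by simp [wnorm]
    rw [this]
    exact mul_nonneg hε.le (Real.sqrt_nonneg _)
  · have hb := h.log_bound hA hP.inv h0
    have h00 : residual A P b x₀ 0 ≠ 0 := fun e => h0 (h.r_eq_zero_of_le e k.zero_le)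
    have hρ := h.rho_pos hP.inv h0
    have hρ0 := h.rho_pos hP.inv h00
    rw [← divLD_eq_psi_sub] at hb
    rw [Real.log_inv] at hk
    unfold wnorm
    rw [← Real.log_le_log_iff (Real.sqrt_pos.2 hρ) (mul_pos hε (Real.sqrt_pos.2 hρ0)),
      Real.log_mul hε.ne' (Real.sqrt_pos.2 hρ0).ne', Real.log_sqrt hρ.le, Real.log_sqrt hρ0.le]
    linarith

end IterationCount

end PCG

theorem mainTheorem8 {𝕜 : Type*} [RCLike 𝕜] (n : ℕ) (A P : Matrix (Fin n) (Fin n) 𝕜)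
    (hA : A.PosDef) (hP : P.PosDef) (htr : (PCG.precond A P).trace = (n : 𝕜))
    (b x₀ : Fin n → 𝕜) (ε : ℝ) (hε : 0 < ε) (hε1 : ε ≤ 1) :
    ∃ i : ℕ, PCG.IsIterationCount A P b x₀ ε i ∧
      (i : ℤ) ≤ ⌈(Real.log 2)⁻¹ * (Real.log ε⁻¹ + PCG.divLD A P)⌉ := by
  have hl2 : 0 < Real.log 2 := Real.log_pos one_lt_two
  set B := (Real.log 2)⁻¹ * (Real.log ε⁻¹ + PCG.divLD A P) with hB
  -- Nonnegativity makes the integer and natural ceilings of B agree.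
  have hB0 : 0 ≤ B :=
    mul_nonneg (inv_nonneg.2 hl2.le)
      (add_nonneg (Real.log_nonneg ((one_le_inv₀ hε).2 hε1)) (PCG.divLD_nonneg hA hP))
  have hmem : PCG.wnorm P⁻¹ (PCG.residual A P b x₀ ⌈B⌉₊) ≤
      ε * PCG.wnorm P⁻¹ (PCG.residual A P b x₀ 0) := by
    refine PCG.wnorm_residual_le hA hP b x₀ hε ?_
    have := Nat.le_ceil B
    rwa [hB, inv_mul_le_iff₀ hl2, mul_comm, ← hB] at this
  classical
  have hex : ∃ k, PCG.wnorm P⁻¹ (PCG.residual A P b x₀ k) ≤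
      ε * PCG.wnorm P⁻¹ (PCG.residual A P b x₀ 0) := ⟨_, hmem⟩
  refine ⟨Nat.find hex, ⟨Nat.find_spec hex, fun k hk => Nat.find_min' hex hk⟩, ?_⟩
  rw [← Int.natCast_ceil_eq_ceil hB0]
  exact_mod_cast Nat.find_min' hex hmem
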